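/- Let $(M,\omega_M)$ be a holomorphic symplectic manifold, i.e. $M$ is a compact Kähler manifold and $\omega_M$ is an everywhere non-degenerate holomorphic $2$-form on $M$. Let $h\in\mathrm{Aut}(M)$ be a biholomorphic automorphism of finite order such that $h^*\omega_M=\omega_M$, and let $F$ be a connected component of the fixed locus $M^h=\{P\in M\mid h(P)=P\}$. Then $F$ is a complex submanifold of $M$, and $(F,\omega_M|_F)$ is again a holomorphic symplectic manifold: $F$ is a compact Kähler manifold and the restriction $\omega_M|_F$ (the pullback of $\omega_M$ along the inclusion $F\hookrightarrow M$) is an everywhere non-degenerate holomorphic $2$-form on $F$. In particular, $\dim_{\mathbb C}F$ is even. (A single point is allowed and counts as a holomorphic symplectic manifold of dimension $0$.) -/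

import Mathlib

open scoped Manifold ContDiff

noncomputable section

namespace HolSymp

section Forms

variable (E : Type*) [NormedAddCommGroup E] [NormedSpace ℂ E]
variable (M : Type*) [TopologicalSpace M] [ChartedSpace E M]

/-- A (not necessarily continuous) field of `ℂ`-bilinear alternating forms on the holomorphic
tangent spaces of a complex manifold `M` modelled on `E`, i.e. a set-theoretic section of the
bundle of `(2,0)`-forms. -/
abbrev ComplexTwoForm : Type _ :=
  ∀ x : M, (TangentSpace 𝓘(ℂ, E) x) [⋀^Fin 2]→L[ℂ] ℂ

/-- A (not necessarily continuous) field of real alternating bilinear forms on the tangent spaces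
of the real manifold underlying a complex manifold `M` modelled on `E`. -/
abbrev RealTwoForm : Type _ :=
  ∀ x : M, (TangentSpace 𝓘(ℂ, E) x) [⋀^Fin 2]→L[ℝ] ℝ

end Forms

section Basic

variable {E : Type*} [NormedAddCommGroup E] [NormedSpace ℂ E]
variable {M : Type*} [TopologicalSpace M] [ChartedSpace E M]
variable {E' : Type*} [NormedAddCommGroup E'] [NormedSpace ℂ E']
variable {N : Type*} [TopologicalSpace N] [ChartedSpace E' N]

/-- The pullback `f^* σ` of a complex 2-form `σ` on `N` along a map `f : M → N`:
`(f^* σ)_x (v, w) = σ_{f x} (df_x v, df_x w)`. -/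
def ComplexTwoForm.pullback (f : M → N) (σ : ComplexTwoForm E' N) : ComplexTwoForm E M :=
  fun x => (σ (f x)).compContinuousLinearMap (mfderiv 𝓘(ℂ, E) 𝓘(ℂ, E') f x)

/-- The differential at `y` of the inverse `e.symm : E → M` of a chart `e`, as a map from the model
space `E` to the tangent space of `M` at `e.symm y` (meaningful for `y ∈ e.target`). -/
def chartSymmDeriv (e : OpenPartialHomeomorph M E) (y : E) :
    E →L[ℂ] TangentSpace 𝓘(ℂ, E) (e.symm y) :=
  mfderiv 𝓘(ℂ, E) 𝓘(ℂ, E) (e.symm : E → M) y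

/-- The expression of a complex 2-form in a chart `e`: its pullback along `e.symm`, a form on the
model space `E` (meaningful on `e.target`). -/
def ComplexTwoForm.inChart (σ : ComplexTwoForm E M) (e : OpenPartialHomeomorph M E) :
    E → E [⋀^Fin 2]→L[ℂ] ℂ :=
  fun y => (σ (e.symm y)).compContinuousLinearMap (chartSymmDeriv e y)

/-- The expression of a real 2-form in a chart `e`: its pullback along `e.symm`. -/
def RealTwoForm.inChart (κ : RealTwoForm E M) (e : OpenPartialHomeomorph M E) :
    E → E [⋀^Fin 2]→L[ℝ] ℝ :=
  fun y => (κ (e.symm y)).compContinuousLinearMap ((chartSymmDeriv e y).restrictScalars ℝ)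

/-- `σ` is a holomorphic 2-form: its expression in every chart is holomorphic. -/
def ComplexTwoForm.IsHolomorphic (σ : ComplexTwoForm E M) : Prop :=
  ∀ e ∈ atlas E M, ContDiffOn ℂ ω (σ.inChart e) e.target

/-- `σ` is everywhere non-degenerate. -/
def ComplexTwoForm.IsNondegenerate (σ : ComplexTwoForm E M) : Prop :=
  ∀ (x : M) (v : TangentSpace 𝓘(ℂ, E) x),
    (∀ w : TangentSpace 𝓘(ℂ, E) x, σ x ![v, w] = 0) → v = 0

/-- `κ` is a Kähler form: a smooth closed real 2-form of type `(1,1)` (that is, invariant under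
multiplication by `i`), which is positive: `κ (v, i v) > 0` for `v ≠ 0`. Equivalently,
`g (v, w) = κ (v, i w)` is a Kähler metric with fundamental form `κ = g (i ·, ·)`. -/
structure RealTwoForm.IsKahler (κ : RealTwoForm E M) : Prop where
  smooth : ∀ e ∈ atlas E M, ContDiffOn ℝ ∞ (κ.inChart e) e.target
  closed : ∀ e ∈ atlas E M, ∀ y ∈ e.target, extDeriv (κ.inChart e) y = 0
  invariant : ∀ (x : M) (v w : TangentSpace 𝓘(ℂ, E) x),
    κ x ![Complex.I • v, Complex.I • w] = κ x ![v, w]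
  positive : ∀ (x : M) (v : TangentSpace 𝓘(ℂ, E) x), v ≠ 0 → 0 < κ x ![v, Complex.I • v]

end Basic

/-- The charted space `M`, modelled on the finite-dimensional complex vector space `E`, is a
compact Kähler manifold: a compact Hausdorff complex manifold that admits a Kähler form. -/
structure IsCompactKahler (E : Type*) [NormedAddCommGroup E] [NormedSpace ℂ E]
    (M : Type*) [TopologicalSpace M] [ChartedSpace E M] : Prop where
  finiteDimensional : FiniteDimensional ℂ E
  isManifold : IsManifold 𝓘(ℂ, E) ω M
  t2Space : T2Space M
  compactSpace : CompactSpace M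
  exists_kahler : ∃ κ : RealTwoForm E M, κ.IsKahler

/-- `(M, σ)` is a holomorphic symplectic manifold: `M` is a compact Kähler manifold and `σ` is an
everywhere non-degenerate holomorphic 2-form on `M`. -/
structure IsHolomorphicSymplectic {E : Type*} [NormedAddCommGroup E] [NormedSpace ℂ E]
    {M : Type*} [TopologicalSpace M] [ChartedSpace E M] (σ : ComplexTwoForm E M) : Prop where
  isCompactKahler : IsCompactKahler E M
  isHolomorphic : σ.IsHolomorphic
  isNondegenerate : σ.IsNondegenerate

end HolSymp

end

/-! Cartan's linearization drives the proof. Let `h` have order dividing `N` and fix `x`, and let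
`A` be its derivative at `x` in a chart `φ`, so `A ^ N = 1`. The average `(1/N) ∑ A^(-k) ∘ φ ∘ h^k`
has the same derivative as `φ` at `x`, hence is a chart near `x`, and it intertwines `h` with `A`
(`exists_chart_linearizing`). In it the fixed locus is the linear subspace `ker (A - 1)`. Its
intersection with a ball is connected, so a component `F` of the fixed locus is straightened near
each of its points (`nonempty_sliceChart_connectedComponentIn`). The dimension of this subspace is
locally constant along `F`, hence constant; the slice charts then form an atlas for which the
inclusion is an embedding.

The Kähler form and `σ` pull back along this holomorphic immersion. For non-degeneracy, the tangent
space of `F` at `p` is the space fixed by `B = dh_p`. If `v` is fixed, invariance gives `σ(v, w) =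
σ(v, w')`, with `w'` the mean of the `B`-orbit of `w`. As `w'` is fixed, a tangent vector of `F`
orthogonal to the tangent space of `F` is orthogonal to everything, hence zero
(`eq_zero_of_forall_fixed`). The dimension is even because an invertible skew-symmetric matrix has
even size. -/

open scoped Topology
open Set Filter

noncomputable section

/-! ### Smooth dependence of pulled-back alternating forms -/

namespace ContinuousAlternatingMap

section

variable {𝕜 E F G ι X : Type*} [NontriviallyNormedField 𝕜]
  [NormedAddCommGroup E] [NormedSpace 𝕜 E] [NormedAddCommGroup F] [NormedSpace 𝕜 F]
  [NormedAddCommGroup G] [NormedSpace 𝕜 G] [NormedAddCommGroup X] [NormedSpace 𝕜 X]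
  [Fintype ι] [DecidableEq ι]

variable (𝕜 E G ι) in
/-- Alternatization of continuous multilinear maps as a continuous linear map. -/
def alternatizationL :
    ContinuousMultilinearMap 𝕜 (fun _ : ι => E) G →L[𝕜] E [⋀^ι]→L[𝕜] G :=
  LinearMap.mkContinuous
    { toFun := fun f => ContinuousMultilinearMap.alternatization f
      map_add' := fun f g => map_add _ f g
      map_smul' := fun c f => by
        ext v
        simp [ContinuousMultilinearMap.alternatization_apply_apply, Finset.smul_sum,
          smul_comm c] }
    (Fintype.card (Equiv.Perm ι)) (fun f => by
      refine ContinuousAlternatingMap.opNorm_le_bound _ (by positivity) fun v => ?_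
      simp only [LinearMap.coe_mk, AddHom.coe_mk,
        ContinuousMultilinearMap.alternatization_apply_apply]
      refine (norm_sum_le _ _).trans ?_
      rw [mul_assoc, ← nsmul_eq_mul, ← Finset.card_univ, ← Finset.sum_const]
      refine Finset.sum_le_sum fun σ _ => ?_
      have h1 : ‖Equiv.Perm.sign σ • f (v ∘ σ)‖ = ‖f (v ∘ σ)‖ := by
        rcases Int.units_eq_one_or (Equiv.Perm.sign σ) with h | h <;> simp [h]
      rw [h1]
      refine (f.le_opNorm _).trans_eq ?_
      congr 1
      exact Equiv.prod_comp σ fun i => ‖v i‖)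

/-- Each signed permutation fixes an alternating map. Division by the factorial thus makes
alternatization a continuous linear retraction onto alternating maps. -/
theorem alternatizationL_toContinuousMultilinearMap (f : E [⋀^ι]→L[𝕜] G) :
    alternatizationL 𝕜 E G ι f.toContinuousMultilinearMap = (Fintype.card ι).factorial • f := by
  ext v
  have h := congrArg (fun g => g v) (AlternatingMap.coe_alternatization f.toAlternatingMap)
  simpa [alternatizationL, ContinuousMultilinearMap.alternatization_apply_apply,
    MultilinearMap.alternatization_apply, Function.comp_def] using h

/-- For plain multilinear maps, composition is linear in `f` and multilinear in the copies of `g`,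
hence smooth. The alternating case follows by forgetting alternation and retracting; characteristic
zero permits the division by the factorial. -/
theorem _root_.ContDiffAt.continuousAlternatingMap_compContinuousLinearMap [CharZero 𝕜]
    {m : ℕ∞ω} {f : X → F [⋀^ι]→L[𝕜] G} {g : X → E →L[𝕜] F} {x : X}
    (hf : ContDiffAt 𝕜 m f x) (hg : ContDiffAt 𝕜 m g x) :
    ContDiffAt 𝕜 m (fun y => (f y).compContinuousLinearMap (g y)) x := by
  have key : (fun y => (f y).compContinuousLinearMap (g y)) = fun y =>
      ((Fintype.card ι).factorial : 𝕜)⁻¹ • alternatizationL 𝕜 E G ι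
        (ContinuousMultilinearMap.compContinuousLinearMapContinuousMultilinear 𝕜
          (fun _ : ι => E) (fun _ => F) G (fun _ => g y)
          (toContinuousMultilinearMapCLM 𝕜 (f y))) := by
    funext y
    have h := alternatizationL_toContinuousMultilinearMap
      ((f y).compContinuousLinearMap (g y))
    rw [eq_inv_smul_iff₀ (by exact_mod_cast Nat.factorial_ne_zero _), Nat.cast_smul_eq_nsmul,
      ← h]
    rfl
  rw [key]
  refine ContDiffAt.const_smul _ ((alternatizationL 𝕜 E G ι).contDiff.contDiffAt.comp x ?_)
  refine ContDiffAt.clm_apply ?_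
    (ContDiffAt.comp x (toContinuousMultilinearMapCLM 𝕜 :
      (F [⋀^ι]→L[𝕜] G) →L[𝕜] _).contDiff.contDiffAt hf)
  exact (ContinuousMultilinearMap.contDiff _).contDiffAt.comp x
    (contDiffAt_pi.2 fun _ => hg)

end

end ContinuousAlternatingMap

/-! ### Pullback of holomorphic and Kähler forms -/

namespace HolSymp

theorem eventually_mem_target_and_mem_source {M N E E' : Type*} [TopologicalSpace M] [TopologicalSpace N]
    [TopologicalSpace E] [TopologicalSpace E'] {f : M → N} (hf : Continuous f)
    {e : OpenPartialHomeomorph M E} {c : OpenPartialHomeomorph N E'} {y : E} (hy : y ∈ e.target)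
    (hfy : f (e.symm y) ∈ c.source) :
    ∀ᶠ z in 𝓝 y, z ∈ e.target ∧ f (e.symm z) ∈ c.source :=
  Filter.Eventually.and (e.open_target.mem_nhds hy)
    ((hf.continuousAt.comp (e.continuousAt_symm hy)).preimage_mem_nhds
      (c.open_source.mem_nhds hfy))

variable {E : Type*} [NormedAddCommGroup E] [NormedSpace ℂ E]
variable {M : Type*} [TopologicalSpace M] [ChartedSpace E M]
variable {E' : Type*} [NormedAddCommGroup E'] [NormedSpace ℂ E']
variable {N : Type*} [TopologicalSpace N] [ChartedSpace E' N]

/-- The pullback of a real 2-form along a map between complex manifolds. -/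
def RealTwoForm.pullback (f : M → N) (κ : RealTwoForm E' N) : RealTwoForm E M :=
  fun x => (κ (f x)).compContinuousLinearMap
    ((mfderiv 𝓘(ℂ, E) 𝓘(ℂ, E') f x).restrictScalars ℝ)

/-- Chain rule for `c.symm ∘ (c ∘ f ∘ e.symm)`, which agrees with `f ∘ e.symm` near `y`. It reduces
pullbacks on manifolds to pullbacks between model spaces. -/
theorem chartSymmDeriv_comp_fderiv [IsManifold 𝓘(ℂ, E) ω M] [IsManifold 𝓘(ℂ, E') ω N]
    {f : M → N} (hf : ContMDiff 𝓘(ℂ, E) 𝓘(ℂ, E') ω f)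
    {e : OpenPartialHomeomorph M E} (he : e ∈ atlas E M)
    {c : OpenPartialHomeomorph N E'} (hc : c ∈ atlas E' N) {y : E} (hy : y ∈ e.target)
    (hfy : f (e.symm y) ∈ c.source) :
    ((chartSymmDeriv c (c (f (e.symm y))) : E' →L[ℂ] E').comp
      (fderiv ℂ (c ∘ f ∘ e.symm) y) : E →L[ℂ] E') =
    (mfderiv 𝓘(ℂ, E) 𝓘(ℂ, E') f (e.symm y) : E →L[ℂ] E').comp (chartSymmDeriv e y) := by
  have hes := mdifferentiableAt_atlas_symm (I := 𝓘(ℂ, E)) he hy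
  have hfm := (hf.mdifferentiable (by simp)) (e.symm y)
  have hcm := mdifferentiableAt_atlas (I := 𝓘(ℂ, E')) hc hfy
  have hcs := mdifferentiableAt_atlas_symm (I := 𝓘(ℂ, E')) hc (c.map_source hfy)
  have h1 : MDifferentiableAt 𝓘(ℂ, E) 𝓘(ℂ, E') (f ∘ e.symm) y := hfm.comp y hes
  have h2 : MDifferentiableAt 𝓘(ℂ, E) 𝓘(ℂ, E') (c ∘ f ∘ e.symm) y := hcm.comp y h1
  have h3 : (c.symm ∘ (c ∘ f ∘ e.symm)) =ᶠ[𝓝 y] f ∘ e.symm := by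
    have := h1.continuousAt.preimage_mem_nhds (c.open_source.mem_nhds hfy)
    filter_upwards [this] with z hz
    exact c.left_inv hz
  have h4 := mfderiv_comp y hcs h2
  rw [h3.mfderiv_eq, mfderiv_comp y hfm hes, mfderiv_eq_fderiv] at h4
  exact h4.symm

theorem ComplexTwoForm.inChart_pullback
    [IsManifold 𝓘(ℂ, E) ω M] [IsManifold 𝓘(ℂ, E') ω N]
    {f : M → N} (hf : ContMDiff 𝓘(ℂ, E) 𝓘(ℂ, E') ω f) (σ : ComplexTwoForm E' N)
    {e : OpenPartialHomeomorph M E} (he : e ∈ atlas E M)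
    {c : OpenPartialHomeomorph N E'} (hc : c ∈ atlas E' N) {y : E} (hy : y ∈ e.target)
    (hfy : f (e.symm y) ∈ c.source) :
    (σ.pullback f : ComplexTwoForm E M).inChart e y = (σ.inChart c ((c ∘ f ∘ e.symm) y)).compContinuousLinearMap
      (fderiv ℂ (c ∘ f ∘ e.symm) y) := by
  have h := chartSymmDeriv_comp_fderiv hf he hc hy hfy
  -- The base points are only propositionally equal, so the values are compared as forms on the
  -- model space, to which every tangent space unfolds.
  have hσ : (σ (c.symm (c (f (e.symm y)))) : E' [⋀^Fin 2]→L[ℂ] ℂ) = σ (f (e.symm y)) :=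
    congrArg (show N → E' [⋀^Fin 2]→L[ℂ] ℂ from σ) (c.left_inv hfy)
  calc (σ.pullback f : ComplexTwoForm E M).inChart e y
      = (σ (f (e.symm y)) : E' [⋀^Fin 2]→L[ℂ] ℂ).compContinuousLinearMap
        ((mfderiv 𝓘(ℂ, E) 𝓘(ℂ, E') f (e.symm y) : E →L[ℂ] E').comp (chartSymmDeriv e y)) := rfl
    _ = _ := by rw [← h, ← hσ]; rfl

theorem RealTwoForm.inChart_pullback
    [IsManifold 𝓘(ℂ, E) ω M] [IsManifold 𝓘(ℂ, E') ω N]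
    {f : M → N} (hf : ContMDiff 𝓘(ℂ, E) 𝓘(ℂ, E') ω f) (κ : RealTwoForm E' N)
    {e : OpenPartialHomeomorph M E} (he : e ∈ atlas E M)
    {c : OpenPartialHomeomorph N E'} (hc : c ∈ atlas E' N) {y : E} (hy : y ∈ e.target)
    (hfy : f (e.symm y) ∈ c.source) :
    (κ.pullback f : RealTwoForm E M).inChart e y = (κ.inChart c ((c ∘ f ∘ e.symm) y)).compContinuousLinearMap
      ((fderiv ℂ (c ∘ f ∘ e.symm) y).restrictScalars ℝ) := by
  have h := chartSymmDeriv_comp_fderiv hf he hc hy hfy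
  have hκ : (κ (c.symm (c (f (e.symm y)))) : E' [⋀^Fin 2]→L[ℝ] ℝ) = κ (f (e.symm y)) :=
    congrArg (show N → E' [⋀^Fin 2]→L[ℝ] ℝ from κ) (c.left_inv hfy)
  calc (κ.pullback f : RealTwoForm E M).inChart e y
      = (κ (f (e.symm y)) : E' [⋀^Fin 2]→L[ℝ] ℝ).compContinuousLinearMap
        (((mfderiv 𝓘(ℂ, E) 𝓘(ℂ, E') f (e.symm y) : E →L[ℂ] E').comp
          (chartSymmDeriv e y)).restrictScalars ℝ) := rfl
    _ = _ := by rw [← h, ← hκ]; rfl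

theorem contDiffAt_comp_comp_symm [IsManifold 𝓘(ℂ, E) ω M] [IsManifold 𝓘(ℂ, E') ω N]
    {f : M → N} (hf : ContMDiff 𝓘(ℂ, E) 𝓘(ℂ, E') ω f)
    {e : OpenPartialHomeomorph M E} (he : e ∈ IsManifold.maximalAtlas 𝓘(ℂ, E) ω M)
    {c : OpenPartialHomeomorph N E'} (hc : c ∈ IsManifold.maximalAtlas 𝓘(ℂ, E') ω N)
    {y : E} (hy : y ∈ e.target) (hfy : f (e.symm y) ∈ c.source) :
    ContDiffAt ℂ ω (c ∘ f ∘ e.symm) y := by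
  rw [← contMDiffAt_iff_contDiffAt]
  exact (contMDiffAt_of_mem_maximalAtlas hc hfy).comp y
    ((hf _).comp y (contMDiffAt_symm_of_mem_maximalAtlas he hy))

theorem ComplexTwoForm.IsHolomorphic.pullback
    [IsManifold 𝓘(ℂ, E) ω M] [IsManifold 𝓘(ℂ, E') ω N] [CompleteSpace E']
    {σ : ComplexTwoForm E' N} (hσ : σ.IsHolomorphic) {f : M → N}
    (hf : ContMDiff 𝓘(ℂ, E) 𝓘(ℂ, E') ω f) : (σ.pullback f : ComplexTwoForm E M).IsHolomorphic := by
  intro e he y hy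
  have hfy := mem_chart_source E' (f (e.symm y))
  have hc := chart_mem_atlas E' (f (e.symm y))
  set c := chartAt E' (f (e.symm y))
  have hg := contDiffAt_comp_comp_symm hf (IsManifold.subset_maximalAtlas he)
    (IsManifold.subset_maximalAtlas hc) hy hfy
  have h1 : ContDiffAt ℂ ω (σ.inChart c) ((c ∘ f ∘ e.symm) y) :=
    (hσ c hc).contDiffAt (c.open_target.mem_nhds (c.map_source hfy))
  refine ContDiffAt.contDiffWithinAt ?_
  refine ((h1.comp y hg).continuousAlternatingMap_compContinuousLinearMap
    (hg.fderiv_right (m := ω) (by simp))).congr_of_eventuallyEq ?_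
  filter_upwards [eventually_mem_target_and_mem_source hf.continuous hy hfy] with z hz
  exact inChart_pullback hf σ he hc hz.1 hz.2

/-- Smoothness and closedness are local, the latter because `d` commutes with pullback. Type `(1,1)`
survives because the differential is complex linear, positivity because it is injective. -/
theorem RealTwoForm.IsKahler.pullback
    [IsManifold 𝓘(ℂ, E) ω M] [IsManifold 𝓘(ℂ, E') ω N]
    {κ : RealTwoForm E' N} (hκ : κ.IsKahler) {f : M → N}
    (hf : ContMDiff 𝓘(ℂ, E) 𝓘(ℂ, E') ω f)
    (hinj : ∀ x, Function.Injective (mfderiv 𝓘(ℂ, E) 𝓘(ℂ, E') f x)) :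
    (κ.pullback f : RealTwoForm E M).IsKahler := by
  have key : ∀ e ∈ atlas E M, ∀ y ∈ e.target, ∃ c ∈ atlas E' N, f (e.symm y) ∈ c.source ∧
      ContDiffAt ℝ ω (c ∘ f ∘ e.symm) y ∧
      ContDiffAt ℝ ∞ (κ.inChart c) ((c ∘ f ∘ e.symm) y) ∧
      (κ.pullback f : RealTwoForm E M).inChart e =ᶠ[𝓝 y] fun z =>
        (κ.inChart c ((c ∘ f ∘ e.symm) z)).compContinuousLinearMap
          (fderiv ℝ (c ∘ f ∘ e.symm) z) := by
    intro e he y hy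
    have hfy := mem_chart_source E' (f (e.symm y))
    have hc := chart_mem_atlas E' (f (e.symm y))
    set c := chartAt E' (f (e.symm y))
    have hg : ∀ z, z ∈ e.target ∧ f (e.symm z) ∈ c.source →
        ContDiffAt ℂ ω (c ∘ f ∘ e.symm) z := fun z hz =>
      contDiffAt_comp_comp_symm hf (IsManifold.subset_maximalAtlas he)
        (IsManifold.subset_maximalAtlas hc) hz.1 hz.2
    refine ⟨c, hc, hfy, (hg y ⟨hy, hfy⟩).restrict_scalars ℝ,
      (hκ.smooth c hc).contDiffAt (c.open_target.mem_nhds (c.map_source hfy)), ?_⟩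
    filter_upwards [eventually_mem_target_and_mem_source hf.continuous hy hfy] with z hz
    rw [inChart_pullback hf κ he hc hz.1 hz.2,
      ((hg z hz).differentiableAt (by simp)).fderiv_restrictScalars ℝ]
  refine ⟨fun e he y hy => ?_, fun e he y hy => ?_, fun x v w => ?_, fun x v hv => ?_⟩
  · obtain ⟨c, -, -, hg, hk, heq⟩ := key e he y hy
    refine ContDiffAt.contDiffWithinAt ?_
    refine ContDiffAt.congr_of_eventuallyEq ?_ heq
    exact (hk.comp y (hg.of_le le_top)).continuousAlternatingMap_compContinuousLinearMap
      ((hg.fderiv_right (m := ω) (by simp)).of_le le_top)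
  · obtain ⟨c, hc, hfy, hg, hk, heq⟩ := key e he y hy
    rw [heq.extDeriv_eq, extDeriv_pullback (r := ω) (hk.differentiableAt (by simp)) hg (by simp),
      show extDeriv (κ.inChart c) ((c ∘ f ∘ e.symm) y) = 0 from
        hκ.closed c hc _ (c.map_source hfy)]
    rfl
  · have h := hκ.invariant (f x) (mfderiv 𝓘(ℂ, E) 𝓘(ℂ, E') f x v)
      (mfderiv 𝓘(ℂ, E) 𝓘(ℂ, E') f x w)
    rw [← map_smul, ← map_smul] at h
    convert h using 1
    · change κ (f x) _ = _
      congr 1; ext i; fin_cases i <;> rfl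
    · change κ (f x) _ = _
      congr 1; ext i; fin_cases i <;> rfl
  · have h := hκ.positive (f x) (mfderiv 𝓘(ℂ, E) 𝓘(ℂ, E') f x v)
      fun h => hv (hinj x (h.trans (map_zero _).symm))
    rw [← map_smul] at h
    convert h using 1
    change κ (f x) _ = _
    congr 1; ext i; fin_cases i <;> rfl

end HolSymp

/-! ### Submanifold structure from slice charts -/

namespace HolSymp

section Slice

variable {E : Type*} [NormedAddCommGroup E] [NormedSpace ℂ E]
variable {M : Type*} [TopologicalSpace M] [ChartedSpace E M]
variable {K C : Type*} [NormedAddCommGroup K] [NormedSpace ℂ K]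
  [NormedAddCommGroup C] [NormedSpace ℂ C]

variable (E K C) in
/-- A holomorphic chart of `M` around `p ∈ S` which straightens the subset `S` to a linear
subspace isomorphic to `K`, with complement `C`. -/
structure SliceChart (S : Set M) (p : S) where
  chart : OpenPartialHomeomorph M E
  equiv : (K × C) ≃L[ℂ] E
  mem_maximalAtlas : chart ∈ IsManifold.maximalAtlas 𝓘(ℂ, E) ω M
  mem_source : p.1 ∈ chart.source
  mem_iff : ∀ y ∈ chart.source, y ∈ S ↔ (equiv.symm (chart y)).2 = 0

namespace SliceChart

variable {S : Set M} {p q : S}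

theorem equiv_fst_zero (s : SliceChart E K C S p) {y : M} (hy : y ∈ s.chart.source) (hyS : y ∈ S) :
    s.equiv ((s.equiv.symm (s.chart y)).1, 0) = s.chart y := by
  rw [← (s.mem_iff y hy).1 hyS]
  exact s.equiv.apply_symm_apply _

theorem symm_mem (s : SliceChart E K C S p) {z : K} (hz : s.equiv (z, 0) ∈ s.chart.target) :
    s.chart.symm (s.equiv (z, 0)) ∈ S := by
  rw [s.mem_iff _ (s.chart.map_target hz), s.chart.right_inv hz, s.equiv.symm_apply_apply]

open Classical in
/-- The chart induced on the straightened subset. -/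
def restrict (s : SliceChart E K C S p) : OpenPartialHomeomorph S K where
  toFun y := (s.equiv.symm (s.chart y)).1
  -- The value `p` is a dummy: on `target` the condition always holds, by `symm_mem`.
  invFun z := if h : s.chart.symm (s.equiv (z, 0)) ∈ S then ⟨_, h⟩ else p
  source := Subtype.val ⁻¹' s.chart.source
  target := {z | s.equiv (z, 0) ∈ s.chart.target}
  map_source' y hy := by
    change s.equiv _ ∈ s.chart.target
    rw [s.equiv_fst_zero hy y.2]
    exact s.chart.map_source hy
  map_target' z hz := by
    rw [mem_preimage, dif_pos (s.symm_mem hz)]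
    exact s.chart.map_target hz
  left_inv' y hy := by
    have h : s.chart.symm (s.equiv ((s.equiv.symm (s.chart y)).1, 0)) = y := by
      rw [s.equiv_fst_zero hy y.2, s.chart.left_inv hy]
    rw [dif_pos (by rw [h]; exact y.2)]
    exact Subtype.ext h
  right_inv' z hz := by
    rw [dif_pos (s.symm_mem hz)]
    change (s.equiv.symm (s.chart (s.chart.symm (s.equiv (z, 0))))).1 = z
    rw [s.chart.right_inv hz, s.equiv.symm_apply_apply]
  open_source := s.chart.open_source.preimage continuous_subtype_val
  open_target := s.chart.open_target.preimage (by fun_prop)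
  continuousOn_toFun := by
    have h : ContinuousOn (fun y : S => s.chart y) (Subtype.val ⁻¹' s.chart.source) :=
      s.chart.continuousOn.comp continuous_subtype_val.continuousOn fun _ hy => hy
    exact (continuous_fst.comp s.equiv.symm.continuous).comp_continuousOn h
  continuousOn_invFun := by
    rw [Topology.IsInducing.subtypeVal.continuousOn_iff]
    have h : ContinuousOn (fun z : K => s.chart.symm (s.equiv (z, 0)))
        {z | s.equiv (z, 0) ∈ s.chart.target} :=
      s.chart.continuousOn_symm.comp
        (s.equiv.continuous.comp (by fun_prop)).continuousOn fun _ hz => hz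
    refine h.congr fun z hz => ?_
    simp only [Function.comp_apply]
    rw [dif_pos (s.symm_mem hz)]

theorem coe_restrict_symm (s : SliceChart E K C S p) {z : K} (hz : z ∈ s.restrict.target) :
    (s.restrict.symm z : M) = s.chart.symm (s.equiv (z, 0)) := by
  classical
  change ((dite _ _ _ : S) : M) = _
  rw [dif_pos (s.symm_mem hz)]

/-- The transition is `z ↦ (z, 0)`, then an ambient transition map, then projection to `K`. -/
theorem contDiffOn_transition [IsManifold 𝓘(ℂ, E) ω M] (s : SliceChart E K C S p)
    (t : SliceChart E K C S q) :
    ContDiffOn ℂ ω (t.restrict ∘ s.restrict.symm)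
      (s.restrict.symm.trans t.restrict).source := by
  intro z hz
  rw [OpenPartialHomeomorph.trans_source] at hz
  have hz1 : z ∈ s.restrict.target := hz.1
  have hz2 : s.chart.symm (s.equiv (z, 0)) ∈ t.chart.source := by
    rw [← s.coe_restrict_symm hz1]
    exact hz.2
  refine ContDiffAt.contDiffWithinAt ?_
  have h1 : ContDiffAt ℂ ω (t.chart ∘ id ∘ s.chart.symm) (s.equiv (z, 0)) :=
    contDiffAt_comp_comp_symm contMDiff_id s.mem_maximalAtlas t.mem_maximalAtlas hz1 hz2
  have h2 : ContDiffAt ℂ ω (fun z : K => s.equiv (z, (0 : C))) z :=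
    s.equiv.contDiff.contDiffAt.comp z (contDiffAt_id.prodMk contDiffAt_const)
  have h3 := (contDiff_fst.comp t.equiv.symm.contDiff).contDiffAt.comp z (h1.comp z h2)
  refine h3.congr_of_eventuallyEq ?_
  filter_upwards [s.restrict.open_target.mem_nhds hz1] with w hw
  change (t.equiv.symm (t.chart (s.restrict.symm w : M))).1 = _
  rw [s.coe_restrict_symm hw]
  rfl

/-- A choice of slice charts around every point makes `S` a charted space. -/
abbrev chartedSpace (s : ∀ p : S, SliceChart E K C S p) : ChartedSpace K S where
  atlas := range fun p => (s p).restrict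
  chartAt p := (s p).restrict
  mem_chart_source p := (s p).mem_source
  chart_mem_atlas p := mem_range_self p

variable (s : ∀ p : S, SliceChart E K C S p)

theorem isManifold [IsManifold 𝓘(ℂ, E) ω M] :
    letI := chartedSpace s
    IsManifold 𝓘(ℂ, K) ω S := by
  let := chartedSpace s
  refine isManifold_of_contDiffOn _ _ _ ?_
  rintro _ _ ⟨p, rfl⟩ ⟨q, rfl⟩
  simpa using (s p).contDiffOn_transition (s q)

/-- In slice charts the inclusion reads `z ↦ equiv (z, 0)`, the normal form of an immersion with
complement `C`. -/
theorem isSmoothEmbedding_val [IsManifold 𝓘(ℂ, E) ω M] :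
    letI := chartedSpace s
    Manifold.IsSmoothEmbedding 𝓘(ℂ, K) 𝓘(ℂ, E) ω (Subtype.val : S → M) := by
  let := chartedSpace s
  have := isManifold s
  refine ⟨Manifold.IsImmersionOfComplement.isImmersion (F := C) fun p => ?_,
    Topology.IsEmbedding.subtypeVal⟩
  refine .mk_of_continuousAt continuous_subtype_val.continuousAt (s p).equiv
    (s p).restrict (s p).chart (s p).mem_source (s p).mem_source
    (IsManifold.subset_maximalAtlas (mem_range_self p)) (s p).mem_maximalAtlas ?_
  intro z hz
  have hz' : z ∈ (s p).restrict.target := by simpa using hz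
  change (s p).chart ((s p).restrict.symm z : M) = (s p).equiv (z, 0)
  rw [(s p).coe_restrict_symm hz']
  exact (s p).chart.right_inv hz'

/-- The `K`-component of the ambient chart, composed with the inclusion, is a chart of `S`, whose
differential is injective. -/
theorem mfderiv_val_injective [IsManifold 𝓘(ℂ, E) ω M] (p : S) :
    letI := chartedSpace s
    Function.Injective (mfderiv 𝓘(ℂ, K) 𝓘(ℂ, E) (Subtype.val : S → M) p) := by
  let := chartedSpace s
  have := isManifold s
  have hv : MDifferentiableAt 𝓘(ℂ, K) 𝓘(ℂ, E) (Subtype.val : S → M) p :=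
    (isSmoothEmbedding_val s).contMDiff.mdifferentiable (by simp) p
  have hg : MDifferentiableAt 𝓘(ℂ, E) 𝓘(ℂ, K)
      (fun y => ((s p).equiv.symm ((s p).chart y)).1) p.1 := by
    have h1 := (contMDiffAt_of_mem_maximalAtlas (s p).mem_maximalAtlas
      (s p).mem_source).mdifferentiableAt (by simp)
    have h2 : MDifferentiableAt 𝓘(ℂ, E) 𝓘(ℂ, K)
        (((ContinuousLinearMap.fst ℂ K C).comp
          ((s p).equiv.symm : E →L[ℂ] K × C))) ((s p).chart p.1) :=
      (ContinuousLinearMap.differentiableAt _).mdifferentiableAt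
    exact h2.comp p.1 h1
  have hc := (mdifferentiable_of_mem_atlas (I := 𝓘(ℂ, K))
    (mem_range_self p : (s p).restrict ∈ atlas K S)).mfderiv_injective (s p).mem_source
  have h := mfderiv_comp p hg hv
  intro v w hvw
  refine hc ?_
  change mfderiv 𝓘(ℂ, K) 𝓘(ℂ, K) ((fun y => ((s p).equiv.symm ((s p).chart y)).1) ∘
    (Subtype.val : S → M)) p v = mfderiv 𝓘(ℂ, K) 𝓘(ℂ, K)
      ((fun y => ((s p).equiv.symm ((s p).chart y)).1) ∘ (Subtype.val : S → M)) p w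
  rw [h]
  exact congrArg (mfderiv 𝓘(ℂ, E) 𝓘(ℂ, K) (fun y => ((s p).equiv.symm ((s p).chart y)).1) p.1) hvw

end SliceChart

end Slice

end HolSymp

/-! ### Linearization at fixed points and local structure of the fixed locus -/

namespace HolSymp

section Linearization

variable {E : Type*} [NormedAddCommGroup E] [NormedSpace ℂ E]
variable {M : Type*} [TopologicalSpace M] [ChartedSpace E M]

/-- Postcomposing a chart with a local biholomorphism yields, after shrinking, a chart. -/
theorem exists_mem_maximalAtlas_eq_comp [CompleteSpace E] [IsManifold 𝓘(ℂ, E) ω M]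
    {φ : OpenPartialHomeomorph M E} (hφ : φ ∈ IsManifold.maximalAtlas 𝓘(ℂ, E) ω M)
    {x : M} (hx : x ∈ φ.source) {g : E → E} {g' : E ≃L[ℂ] E} (hg : ContDiffAt ℂ ω g (φ x))
    (hg' : HasFDerivAt g (g' : E →L[ℂ] E) (φ x)) :
    ∃ ψ ∈ IsManifold.maximalAtlas 𝓘(ℂ, E) ω M, x ∈ ψ.source ∧ ψ.source ⊆ φ.source ∧
      ∀ y, ψ y = g (φ y) := by
  set T := hg.toOpenPartialHomeomorph g hg' (by simp) with hT
  have hxT : φ x ∈ T.source := hg.mem_toOpenPartialHomeomorph_source hg' (by simp)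
  have h1 : ∀ᶠ z in 𝓝 (φ x), ContDiffAt ℂ ω g z := hg.eventually (by simp)
  have h2 : ∀ᶠ w in 𝓝 (T (φ x)), ContDiffAt ℂ ω T.symm w :=
    (hg.to_localInverse hg' (by simp)).eventually (by simp)
  have h3 : ∀ᶠ z in 𝓝 (φ x), ContDiffAt ℂ ω g z ∧ ContDiffAt ℂ ω T.symm (T z) :=
    h1.and ((T.continuousAt hxT).eventually h2)
  -- The inverse function theorem gives regularity at one point only; `U` is where both `g` and its
  -- local inverse are analytic.
  obtain ⟨U, hU, hUo, hxU⟩ := eventually_nhds_iff.1 h3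
  refine ⟨φ.trans (T.restrOpen U hUo), ?_, ?_, ?_, fun y => rfl⟩
  · refine OpenPartialHomeomorph.mem_maximalAtlas_of_contMDiffOn _ ?_ ?_
    · intro y hy
      have hy' : y ∈ φ.source ∧ φ y ∈ T.source ∩ U := hy
      refine ContMDiffAt.contMDiffWithinAt ?_
      exact ((hU _ hy'.2.2).1.contMDiffAt).comp y (contMDiffAt_of_mem_maximalAtlas hφ hy'.1)
    · intro w hw
      rw [OpenPartialHomeomorph.trans_target] at hw
      have hw1 : w ∈ T.target ∩ T.symm ⁻¹' U := by
        simpa [OpenPartialHomeomorph.restrOpen] using hw.1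
      have hw2 : T.symm w ∈ φ.target := hw.2
      refine ContMDiffAt.contMDiffWithinAt ?_
      have h4 := (hU _ hw1.2).2
      rw [T.right_inv hw1.1] at h4
      exact (contMDiffAt_symm_of_mem_maximalAtlas hφ hw2).comp w h4.contMDiffAt
  · exact ⟨hx, hxT, hxU⟩
  · exact fun y hy => hy.1

theorem hasFDerivAt_comp_iterate_comp_symm [IsManifold 𝓘(ℂ, E) ω M]
    {φ : OpenPartialHomeomorph M E} (hφ : φ ∈ IsManifold.maximalAtlas 𝓘(ℂ, E) ω M)
    {f : M → M} (hf : ContMDiff 𝓘(ℂ, E) 𝓘(ℂ, E) ω f) {x : M} (hx : x ∈ φ.source)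
    (hfx : f x = x) (k : ℕ) :
    HasFDerivAt (φ ∘ f^[k] ∘ φ.symm) (fderiv ℂ (φ ∘ f ∘ φ.symm) (φ x) ^ k) (φ x) := by
  have hφx := φ.left_inv hx
  have hfφ : f (φ.symm (φ x)) ∈ φ.source := by rwa [hφx, hfx]
  induction k with
  | zero =>
    refine (hasFDerivAt_id (𝕜 := ℂ) (φ x)).congr_of_eventuallyEq ?_
    filter_upwards [φ.open_target.mem_nhds (φ.map_source hx)] with z hz
    exact φ.right_inv hz
  | succ k ih =>
    have h1 : HasFDerivAt (φ ∘ f ∘ φ.symm) (fderiv ℂ (φ ∘ f ∘ φ.symm) (φ x)) (φ x) :=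
      ((contDiffAt_comp_comp_symm hf hφ hφ (φ.map_source hx) hfφ).differentiableAt
        (by simp)).hasFDerivAt
    have h2 : (φ ∘ f ∘ φ.symm) (φ x) = φ x := by simp [hφx, hfx]
    rw [pow_succ]
    refine (HasFDerivAt.comp (φ x) (by rwa [h2]) h1).congr_of_eventuallyEq ?_
    filter_upwards [eventually_mem_target_and_mem_source hf.continuous
      (φ.map_source hx) hfφ] with z hz
    simp [φ.left_inv hz.2]

/-- A holomorphic self-map of finite order is linear in a suitable chart around a fixed point. -/
theorem exists_chart_linearizing [CompleteSpace E] [IsManifold 𝓘(ℂ, E) ω M]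
    {f : M → M} (hf : ContMDiff 𝓘(ℂ, E) 𝓘(ℂ, E) ω f) {N : ℕ} (hN : 0 < N) (hfN : f^[N] = id)
    {x : M} (hfx : f x = x) :
    ∃ ψ ∈ IsManifold.maximalAtlas 𝓘(ℂ, E) ω M, x ∈ ψ.source ∧ ∃ A : E →L[ℂ] E, A ^ N = 1 ∧
      ∀ y ∈ ψ.source, f y ∈ ψ.source ∧ ψ (f y) = A (ψ y) := by
  set φ := chartAt E x with hφd
  have hφ : φ ∈ IsManifold.maximalAtlas 𝓘(ℂ, E) ω M := IsManifold.chart_mem_maximalAtlas x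
  have hx : x ∈ φ.source := mem_chart_source E x
  have hφx := φ.left_inv hx
  set A := fderiv ℂ (φ ∘ f ∘ φ.symm) (φ x) with hA
  have hk := hasFDerivAt_comp_iterate_comp_symm hφ hf hx hfx
  have hAN : A ^ N = 1 := by
    have h := hk N
    rw [hfN] at h
    exact h.unique (hk 0)
  have hfk : ∀ k, ContMDiff 𝓘(ℂ, E) 𝓘(ℂ, E) ω f^[k] := fun k => by
    induction k with
    | zero => exact contMDiff_id
    | succ k ih => exact ih.comp hf
  have hN' : (N : ℂ) ≠ 0 := by exact_mod_cast hN.ne'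
  -- The average over the cyclic group, read in `φ`; `A ^ (N - k)` stands for `A^(-k)` since `A ^ N
  -- = 1`.
  let g : E → E := fun z =>
    (N : ℂ)⁻¹ • ∑ k ∈ Finset.range N, (A ^ (N - k)) ((φ ∘ f^[k] ∘ φ.symm) z)
  have hg : ContDiffAt ℂ ω g (φ x) := by
    refine ContDiffAt.const_smul _ (ContDiffAt.sum fun k _ => ?_)
    refine (A ^ (N - k)).contDiff.contDiffAt.comp _ ?_
    refine contDiffAt_comp_comp_symm (hfk k) hφ hφ (φ.map_source hx) ?_
    rw [hφx, Function.iterate_fixed hfx]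
    exact hx
  have hg' : HasFDerivAt g ((ContinuousLinearEquiv.refl ℂ E : E ≃L[ℂ] E) : E →L[ℂ] E) (φ x) := by
    have h : HasFDerivAt g
        ((N : ℂ)⁻¹ • ∑ k ∈ Finset.range N, (A ^ (N - k)).comp (A ^ k)) (φ x) :=
      (HasFDerivAt.fun_sum fun k _ => (A ^ (N - k)).hasFDerivAt.comp (φ x) (hk k)).const_smul _
    convert h using 1
    have h' : ∀ k ∈ Finset.range N, (A ^ (N - k)).comp (A ^ k) = 1 := fun k hk => by
      rw [← ContinuousLinearMap.mul_def, ← pow_add,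
        Nat.sub_add_cancel (Finset.mem_range.1 hk).le, hAN]
    rw [Finset.sum_congr rfl h', Finset.sum_const, Finset.card_range,
      ← Nat.cast_smul_eq_nsmul ℂ, inv_smul_smul₀ hN']
    rfl
  obtain ⟨ψ, hψ, hxψ, hψφ, hψg⟩ := exists_mem_maximalAtlas_eq_comp hφ hx hg hg'
  have hper : ∀ y, Function.IsPeriodicPt f N y := fun y => congrFun hfN y
  -- Intersecting over a full period makes the domain stable under `f`.
  let W : Set M := ⋂ k ∈ Finset.range N, f^[k] ⁻¹' ψ.source
  have hWo : IsOpen W := isOpen_biInter_finset fun k _ =>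
    ψ.open_source.preimage (hfk k).continuous
  have hW : ∀ y, y ∈ W ↔ ∀ k, f^[k] y ∈ ψ.source := fun y => by
    simp only [W, mem_iInter, Finset.mem_range, mem_preimage]
    refine ⟨fun h k => ?_, fun h k _ => h k⟩
    rw [← (hper y).iterate_mod_apply]
    exact h _ (Nat.mod_lt _ hN)
  refine ⟨ψ.restr W, restr_mem_maximalAtlas _ hψ hWo, ?_, A, hAN, fun y hy => ?_⟩
  · rw [ψ.restr_source' W hWo]
    exact ⟨hxψ, (hW x).2 fun k => by rwa [Function.iterate_fixed hfx]⟩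
  · rw [ψ.restr_source' W hWo] at hy ⊢
    have hy' := (hW y).1 hy.2
    refine ⟨⟨hy' 1, (hW _).2 fun k => hy' (k + 1)⟩, ?_⟩
    change ψ (f y) = A (ψ y)
    have hval : ∀ z ∈ ψ.source,
        ψ z = (N : ℂ)⁻¹ • ∑ k ∈ Finset.range N, (A ^ (N - k)) (φ (f^[k] z)) := fun z hz => by
      rw [hψg]
      simp only [g, Function.comp_apply, φ.left_inv (hψφ hz)]
    rw [hval (f y) (hy' 1), hval _ hy.1, map_smul, map_sum]
    congr 1
    have e1 : ∀ k ∈ Finset.range N,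
        (A ^ (N - k)) (φ (f^[k] (f y))) = A ((A ^ (N - (k + 1))) (φ (f^[k + 1] y))) :=
      fun k hk => by
        have : N - k = (N - (k + 1)) + 1 := by have := Finset.mem_range.1 hk; omega
        rw [this, pow_succ']
        rfl
    rw [Finset.sum_congr rfl e1]
    -- The sums for `f y` and `y` differ by a shift of index. Splitting the sum over `0, …, N` at
    -- either end compares them: the end terms agree as `A ^ N = 1` and `f^[N] = id`.
    have e2 := Finset.sum_range_succ (fun k => A ((A ^ (N - k)) (φ (f^[k] y)))) N
    rw [Finset.sum_range_succ'] at e2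
    simpa [hAN, hfN] using e2

variable (E) in
/-- The derivative of a map between complex manifolds, viewed as a linear map between the model
spaces. -/
def modelDeriv (E' : Type*) [NormedAddCommGroup E'] [NormedSpace ℂ E'] {N : Type*}
    [TopologicalSpace N] [ChartedSpace E' N] (f : M → N) (x : M) : E →L[ℂ] E' :=
  mfderiv 𝓘(ℂ, E) 𝓘(ℂ, E') f x

theorem modelDeriv_comp {E₁ E₂ : Type*} [NormedAddCommGroup E₁] [NormedSpace ℂ E₁]
    [NormedAddCommGroup E₂] [NormedSpace ℂ E₂] {M₁ M₂ : Type*}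
    [TopologicalSpace M₁] [ChartedSpace E₁ M₁] [TopologicalSpace M₂] [ChartedSpace E₂ M₂]
    {g : M₁ → M₂} {f : M → M₁} {x : M} (hg : MDifferentiableAt 𝓘(ℂ, E₁) 𝓘(ℂ, E₂) g (f x))
    (hf : MDifferentiableAt 𝓘(ℂ, E) 𝓘(ℂ, E₁) f x) :
    modelDeriv E E₂ (g ∘ f) x = (modelDeriv E₁ E₂ g (f x)).comp (modelDeriv E E₁ f x) :=
  mfderiv_comp x hg hf

/-- The dimension of the space of tangent vectors at `x` fixed by the differential of `f`. -/
def fixedDim (f : M → M) (x : M) : ℕ :=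
  Module.finrank ℂ (LinearMap.ker
    ((modelDeriv E E f x).toLinearMap - LinearMap.id))

/-- Differentiate `ψ ∘ f = A ∘ ψ` at a fixed point: `dψ` conjugates `df` to `A`. -/
theorem mfderiv_chart_linearizing [IsManifold 𝓘(ℂ, E) ω M]
    {f : M → M} (hf : ContMDiff 𝓘(ℂ, E) 𝓘(ℂ, E) ω f)
    {ψ : OpenPartialHomeomorph M E} (hψ : ψ ∈ IsManifold.maximalAtlas 𝓘(ℂ, E) ω M)
    {A : E →L[ℂ] E} (hA : ∀ y ∈ ψ.source, f y ∈ ψ.source ∧ ψ (f y) = A (ψ y))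
    {x : M} (hx : x ∈ ψ.source) (hfx : f x = x) (v : E) :
    modelDeriv E E ψ x
      (modelDeriv E E f x v) =
    A (modelDeriv E E ψ x v) := by
  have hfm : MDifferentiableAt 𝓘(ℂ, E) 𝓘(ℂ, E) f x := hf.mdifferentiable (by simp) x
  have hψm : ∀ y ∈ ψ.source, MDifferentiableAt 𝓘(ℂ, E) 𝓘(ℂ, E) ψ y := fun y hy =>
    (contMDiffAt_of_mem_maximalAtlas hψ hy).mdifferentiableAt (by simp)
  have h1 := modelDeriv_comp (hψm (f x) (hA x hx).1) hfm
  have h2 := modelDeriv_comp (A.differentiableAt (x := ψ x)).mdifferentiableAt (hψm x hx)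
  have h3 : ψ ∘ f =ᶠ[𝓝 x] A ∘ ψ := by
    filter_upwards [ψ.open_source.mem_nhds hx] with y hy
    exact (hA y hy).2
  have h4 : modelDeriv E E (ψ ∘ f) x = modelDeriv E E (A ∘ ψ) x := h3.mfderiv_eq
  have h5 : modelDeriv E E A (ψ x) = A := mfderiv_eq_fderiv.trans A.fderiv
  rw [h1, h2, h5, hfx] at h4
  exact DFunLike.congr_fun h4 v

theorem bijective_mfderiv_of_mem_maximalAtlas [IsManifold 𝓘(ℂ, E) ω M]
    {ψ : OpenPartialHomeomorph M E} (hψ : ψ ∈ IsManifold.maximalAtlas 𝓘(ℂ, E) ω M)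
    {x : M} (hx : x ∈ ψ.source) :
    Function.Bijective (modelDeriv E E ψ x) := by
  refine OpenPartialHomeomorph.MDifferentiable.mfderiv_bijective ⟨?_, ?_⟩ hx
  · exact (contMDiffOn_of_mem_maximalAtlas hψ).mdifferentiableOn (by simp)
  · exact (contMDiffOn_symm_of_mem_maximalAtlas hψ).mdifferentiableOn (by simp)

/-- The right-hand side does not involve `x`, which is what makes `fixedDim` locally constant on the
fixed locus. -/
theorem fixedDim_eq_of_chart_linearizing [IsManifold 𝓘(ℂ, E) ω M]
    {f : M → M} (hf : ContMDiff 𝓘(ℂ, E) 𝓘(ℂ, E) ω f)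
    {ψ : OpenPartialHomeomorph M E} (hψ : ψ ∈ IsManifold.maximalAtlas 𝓘(ℂ, E) ω M)
    {A : E →L[ℂ] E} (hA : ∀ y ∈ ψ.source, f y ∈ ψ.source ∧ ψ (f y) = A (ψ y))
    {x : M} (hx : x ∈ ψ.source) (hfx : f x = x) :
    fixedDim (E := E) f x =
      Module.finrank ℂ (LinearMap.ker (A.toLinearMap - LinearMap.id)) := by
  have hbij := bijective_mfderiv_of_mem_maximalAtlas hψ hx
  let D : E ≃ₗ[ℂ] E :=
    LinearEquiv.ofBijective (modelDeriv E E ψ x).toLinearMap hbij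
  have hD : ∀ v : E, D (modelDeriv E E f x v) = A (D v) :=
    mfderiv_chart_linearizing hf hψ hA hx hfx
  have hker : LinearMap.ker (A.toLinearMap - LinearMap.id) = (LinearMap.ker
      ((modelDeriv E E f x).toLinearMap - LinearMap.id)).map
        (D : E →ₗ[ℂ] E) := by
    ext v
    rw [Submodule.mem_map]
    simp only [LinearMap.mem_ker, LinearMap.sub_apply, LinearMap.id_apply, sub_eq_zero,
      ContinuousLinearMap.coe_coe]
    refine ⟨fun h => ⟨D.symm v, D.injective ?_, D.apply_symm_apply v⟩, ?_⟩
    · rw [hD, D.apply_symm_apply, h]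
    · rintro ⟨w, hw, rfl⟩
      exact (hD w).symm.trans (congrArg D hw)
  rw [hker]
  exact (D.finrank_map_eq _).symm

theorem mfderiv_pow_eq_one [CompleteSpace E] [IsManifold 𝓘(ℂ, E) ω M]
    {f : M → M} (hf : ContMDiff 𝓘(ℂ, E) 𝓘(ℂ, E) ω f) {N : ℕ} (hN : 0 < N) (hfN : f^[N] = id)
    {x : M} (hfx : f x = x) : modelDeriv E E f x ^ N = 1 := by
  obtain ⟨ψ, hψ, hx, A, hAN, hA⟩ := exists_chart_linearizing hf hN hfN hfx
  have h := mfderiv_chart_linearizing hf hψ hA hx hfx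
  have hk : ∀ (k : ℕ) (v : E), modelDeriv E E ψ x
      ((modelDeriv E E f x ^ k) v) =
      (A ^ k) (modelDeriv E E ψ x v) := by
    intro k
    induction k with
    | zero => intro v; rfl
    | succ k ih =>
      intro v
      rw [pow_succ, pow_succ]
      exact (ih _).trans (congrArg _ (h v))
  ext v
  refine (bijective_mfderiv_of_mem_maximalAtlas hψ hx).1 ?_
  refine (hk N v).trans ?_
  rw [hAN]
  rfl

theorem exists_continuousLinearEquiv_prod [FiniteDimensional ℂ E] (V : Submodule ℂ E) {n r : ℕ}
    (hn : Module.finrank ℂ E = n) (hr : Module.finrank ℂ V = r) :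
    ∃ L : (EuclideanSpace ℂ (Fin r) × EuclideanSpace ℂ (Fin (n - r))) ≃L[ℂ] E,
      ∀ v, (L.symm v).2 = 0 ↔ v ∈ V := by
  obtain ⟨W, hW⟩ := V.exists_isCompl
  have hdim := Submodule.finrank_add_eq_of_isCompl hW
  let a : EuclideanSpace ℂ (Fin r) ≃ₗ[ℂ] V :=
    LinearEquiv.ofFinrankEq _ _ (by simp [hr])
  let b : EuclideanSpace ℂ (Fin (n - r)) ≃ₗ[ℂ] W :=
    LinearEquiv.ofFinrankEq _ _ (by simp; omega)
  refine ⟨((a.prodCongr b).trans (V.prodEquivOfIsCompl W hW)).toContinuousLinearEquiv,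
    fun v => ?_⟩
  rw [← Submodule.prodEquivOfIsCompl_symm_apply_snd_eq_zero V W hW, ← b.symm.map_eq_zero_iff]
  rfl

/-- A connected component of the fixed locus of a holomorphic map of finite order can be
straightened around each of its points. -/
theorem nonempty_sliceChart_connectedComponentIn [FiniteDimensional ℂ E]
    [IsManifold 𝓘(ℂ, E) ω M] {f : M → M} (hf : ContMDiff 𝓘(ℂ, E) 𝓘(ℂ, E) ω f)
    {N : ℕ} (hN : 0 < N) (hfN : f^[N] = id) {n : ℕ} (hn : Module.finrank ℂ E = n) (x₀ : M)
    (p : connectedComponentIn (Function.fixedPoints f) x₀) :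
    Nonempty (SliceChart E (EuclideanSpace ℂ (Fin (fixedDim (E := E) f p.1)))
      (EuclideanSpace ℂ (Fin (n - fixedDim (E := E) f p.1)))
      (connectedComponentIn (Function.fixedPoints f) x₀) p) := by
  have : CompleteSpace E := FiniteDimensional.complete ℂ E
  have hfp : f p = p := connectedComponentIn_subset (Function.fixedPoints f) x₀ p.2
  obtain ⟨ψ, hψ, hp, A, -, hA⟩ := exists_chart_linearizing hf hN hfN hfp
  obtain ⟨L, hL⟩ := exists_continuousLinearEquiv_prod
    (LinearMap.ker (A.toLinearMap - LinearMap.id)) hn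
    (fixedDim_eq_of_chart_linearizing hf hψ hA hp hfp).symm
  have hL' : ∀ v, (L.symm v).2 = 0 ↔ A v = v := fun v => by
    rw [hL, LinearMap.mem_ker, LinearMap.sub_apply, sub_eq_zero]
    rfl
  have hfix : ∀ y ∈ ψ.source, f y = y ↔ A (ψ y) = ψ y := fun y hy => by
    rw [← (hA y hy).2, ψ.injOn.eq_iff (hA y hy).1 hy]
  -- Shrinking to a ball makes the fixed points in the chart domain a convex slice in coordinates.
  -- They are therefore connected to `p` and lie in its component.
  obtain ⟨ε, hε, hball⟩ := Metric.isOpen_iff.1 ψ.open_target _ (ψ.map_source hp)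
  let W : Set M := ψ.source ∩ ψ ⁻¹' Metric.ball (ψ p) ε
  have hWo : IsOpen W := ψ.isOpen_inter_preimage Metric.isOpen_ball
  have hsrc : (ψ.restr W).source = W := by
    rw [ψ.restr_source' W hWo, inter_eq_right]
    exact inter_subset_left
  have hpW : p.1 ∈ W := ⟨hp, Metric.mem_ball_self hε⟩
  refine ⟨⟨ψ.restr W, L, restr_mem_maximalAtlas _ hψ hWo, by rwa [hsrc], fun y hy => ?_⟩⟩
  rw [hsrc] at hy
  change _ ↔ (L.symm (ψ y)).2 = 0
  rw [hL', ← hfix y hy.1]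
  refine ⟨fun h => connectedComponentIn_subset (Function.fixedPoints f) x₀ h, fun h => ?_⟩
  let B : Set E := Metric.ball (ψ p) ε ∩ LinearMap.ker (A.toLinearMap - LinearMap.id)
  have hker : ∀ v, v ∈ LinearMap.ker (A.toLinearMap - LinearMap.id) ↔ A v = v := fun v => by
    rw [← hL, hL']
  have hBpre : IsPreconnected (ψ.symm '' B) := by
    refine IsPreconnected.image ?_ _ (ψ.continuousOn_symm.mono fun z hz => hball hz.1)
    have h1 : Convex ℝ ((LinearMap.ker (A.toLinearMap - LinearMap.id) : Submodule ℂ E) : Set E) :=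
      ((LinearMap.ker (A.toLinearMap - LinearMap.id)).restrictScalars ℝ).convex
    exact ((convex_ball _ _).inter h1).isPreconnected
  have hBsub : ψ.symm '' B ⊆ Function.fixedPoints f := by
    rintro _ ⟨z, hz, rfl⟩
    have hzt := hball hz.1
    refine (hfix _ (ψ.map_target hzt)).2 ?_
    rw [ψ.right_inv hzt]
    exact (hker z).1 hz.2
  have hmem : ∀ y ∈ W, f y = y → y ∈ ψ.symm '' B := fun y hy hfy =>
    ⟨ψ y, ⟨hy.2, (hker _).2 ((hfix y hy.1).1 hfy)⟩, ψ.left_inv hy.1⟩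
  rw [connectedComponentIn_eq p.2]
  exact hBpre.subset_connectedComponentIn (hmem _ hpW hfp) hBsub (hmem y hy h)

theorem fixedDim_eq_of_isPreconnected [CompleteSpace E] [IsManifold 𝓘(ℂ, E) ω M]
    {f : M → M} (hf : ContMDiff 𝓘(ℂ, E) 𝓘(ℂ, E) ω f) {N : ℕ} (hN : 0 < N) (hfN : f^[N] = id)
    {S : Set M} (hS : IsPreconnected S) (hSf : S ⊆ Function.fixedPoints f) {x y : M}
    (hx : x ∈ S) (hy : y ∈ S) : fixedDim (E := E) f x = fixedDim (E := E) f y := by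
  have : PreconnectedSpace S := isPreconnected_iff_preconnectedSpace.1 hS
  have hloc : IsLocallyConstant fun p : S => fixedDim (E := E) f p := by
    rw [IsLocallyConstant.iff_eventually_eq]
    intro p
    obtain ⟨ψ, hψ, hp, A, -, hA⟩ := exists_chart_linearizing hf hN hfN (hSf p.2)
    have hev : ∀ᶠ q : S in 𝓝 p, q.1 ∈ ψ.source :=
      continuous_subtype_val.continuousAt.preimage_mem_nhds (ψ.open_source.mem_nhds hp)
    filter_upwards [hev] with q hq
    rw [fixedDim_eq_of_chart_linearizing hf hψ hA hq (hSf q.2),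
      fixedDim_eq_of_chart_linearizing hf hψ hA hp (hSf p.2)]
  exact hloc.apply_eq_of_preconnectedSpace (⟨x, hx⟩ : S) ⟨y, hy⟩

end Linearization

end HolSymp

/-! ### Non-degenerate alternating forms and invariance -/

namespace HolSymp

section AlternatingForms

variable {V : Type*} [NormedAddCommGroup V] [NormedSpace ℂ V]

/-- A non-degenerate alternating bilinear form lives on an even-dimensional space. -/
theorem even_of_nondegenerate {r : ℕ} (β : EuclideanSpace ℂ (Fin r) [⋀^Fin 2]→L[ℂ] ℂ)
    (hβ : ∀ v, (∀ w, β ![v, w] = 0) → v = 0) : Even r := by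
  let b := EuclideanSpace.basisFun (Fin r) ℂ
  let A : Matrix (Fin r) (Fin r) ℂ := Matrix.of fun i j => β ![b i, b j]
  have hswap : ∀ v w, β ![v, w] = -β ![w, v] := fun v w => by
    have h := β.map_swap ![w, v] (i := 0) (j := 1) (by decide)
    refine Eq.trans ?_ h
    change β _ = β _
    congr 1
    ext i
    fin_cases i <;> rfl
  have hsum : ∀ (v : EuclideanSpace ℂ (Fin r)) (c : Fin r → EuclideanSpace ℂ (Fin r))
      (a : Fin r → ℂ), β ![v, ∑ j, a j • c j] = ∑ j, a j * β ![v, c j] := fun v c a => by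
    have h := map_sum (β.toContinuousMultilinearMap.toContinuousLinearMap ![v, 0] 1)
      (fun j => a j • c j) Finset.univ
    have hu : ∀ w, Function.update ![v, 0] 1 w = ![v, w] := fun w => by
      ext i
      fin_cases i <;> rfl
    simpa [hu, map_smul, -map_sum] using h
  have hA : A.transpose = -A := by
    ext i j
    exact hswap (b j) (b i)
  -- A kernel vector of the Gram matrix would give the coordinates of a vector orthogonal to
  -- everything.
  have hdet : A.det ≠ 0 := by
    intro h0
    obtain ⟨a, ha, hAa⟩ := Matrix.exists_mulVec_eq_zero_iff.2 h0
    have h1 : (∑ j, a j • b j) = 0 := by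
      refine hβ _ fun w => ?_
      rw [hswap, ← b.sum_repr w, hswap, hsum, neg_neg]
      refine Finset.sum_eq_zero fun i _ => ?_
      have h2 := congrFun hAa i
      rw [hswap, hsum]
      simp only [Matrix.mulVec, dotProduct, A, Matrix.of_apply, Pi.zero_apply] at h2
      simp only [mul_comm (a _), h2, neg_zero, mul_zero]
    refine ha (funext fun i => ?_)
    have h3 := b.toBasis.linearIndependent
    rw [Fintype.linearIndependent_iff] at h3
    exact h3 a (by simpa using h1) i
  have h := A.det_transpose
  rw [hA, Matrix.det_neg, Fintype.card_fin] at h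
  have h1 : (-1 : ℂ) ^ r = 1 := mul_right_cancel₀ hdet (by rw [h, one_mul])
  by_contra hr
  rw [Nat.not_even_iff_odd] at hr
  rw [hr.neg_one_pow] at h1
  norm_num at h1

/-- If `β` is invariant under an automorphism `B` of finite order, then a fixed vector of `B` which
is `β`-orthogonal to all fixed vectors is `β`-orthogonal to everything. -/
theorem eq_zero_of_forall_fixed {β : V [⋀^Fin 2]→L[ℂ] ℂ} {B : V →L[ℂ] V} {N : ℕ} (hN : 0 < N)
    (hB : B ^ N = 1) (hβ : β.compContinuousLinearMap B = β) {v : V} (hv : B v = v)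
    (h : ∀ w, B w = w → β ![v, w] = 0) (w : V) : β ![v, w] = 0 := by
  have hinv : ∀ w, β ![v, B w] = β ![v, w] := fun w => by
    conv_rhs => rw [← hβ]
    rw [ContinuousAlternatingMap.compContinuousLinearMap_apply]
    congr 1
    ext i
    fin_cases i
    · exact hv.symm
    · rfl
  have hpow : ∀ k : ℕ, β ![v, (B ^ k) w] = β ![v, w] := fun k => by
    induction k with
    | zero => rfl
    | succ k ih =>
      rw [pow_succ']
      exact (hinv _).trans ih
  have hu : ∀ w, Function.update ![v, 0] 1 w = ![v, w] := fun w => by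
    ext i
    fin_cases i <;> rfl
  -- The orbit sum of `w` is fixed by `B`, so it pairs to zero with `v`; by invariance that pairing
  -- is also `N * β ![v, w]`.
  have hsum := map_sum (β.toContinuousMultilinearMap.toContinuousLinearMap ![v, 0] 1)
    (fun k => (B ^ k) w) (Finset.range N)
  have hsum' : β ![v, ∑ k ∈ Finset.range N, (B ^ k) w] =
      ∑ k ∈ Finset.range N, β ![v, (B ^ k) w] := by
    simpa [hu, -map_sum] using hsum
  rw [h, Finset.sum_congr rfl fun k _ => hpow k, Finset.sum_const, Finset.card_range,
    nsmul_eq_mul, eq_comm, mul_eq_zero] at hsum'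
  · exact hsum'.resolve_left (by exact_mod_cast hN.ne')
  · have e := Finset.sum_range_succ (fun k => (B ^ k) w) N
    rw [Finset.sum_range_succ', hB] at e
    rw [map_sum]
    simpa [pow_succ'] using e

end AlternatingForms

/-! ### Non-degeneracy on the fixed locus -/

section Pullback

variable {E : Type*} [NormedAddCommGroup E] [NormedSpace ℂ E] [FiniteDimensional ℂ E]
variable {M : Type*} [TopologicalSpace M] [ChartedSpace E M]
variable {K : Type*} [NormedAddCommGroup K] [NormedSpace ℂ K]
variable {S : Type*} [TopologicalSpace S] [ChartedSpace K S]

/-- A form invariant under a map `f` of finite order restricts to a non-degenerate form on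
the submanifolds of the fixed locus of `f` of maximal dimension. -/
theorem ComplexTwoForm.IsNondegenerate.pullback_fixed [IsManifold 𝓘(ℂ, E) ω M]
    {σ : ComplexTwoForm E M} (hσ : σ.IsNondegenerate) {f : M → M}
    (hf : ContMDiff 𝓘(ℂ, E) 𝓘(ℂ, E) ω f) (hfσ : σ.pullback f = σ) {N : ℕ} (hN : 0 < N)
    (hfN : f^[N] = id) {ι : S → M} (hι : MDifferentiable 𝓘(ℂ, K) 𝓘(ℂ, E) ι)
    (hιf : ∀ p, f (ι p) = ι p)
    (hinj : ∀ p, Function.Injective (mfderiv 𝓘(ℂ, K) 𝓘(ℂ, E) ι p))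
    (hdim : ∀ p, fixedDim (E := E) f (ι p) = Module.finrank ℂ K) :
    (σ.pullback ι : ComplexTwoForm K S).IsNondegenerate := by
  have : CompleteSpace E := FiniteDimensional.complete ℂ E
  intro p v hv
  let B : E →L[ℂ] E := modelDeriv E E f (ι p)
  let D : K →L[ℂ] E := modelDeriv K E ι p
  let s : M → E [⋀^Fin 2]→L[ℂ] ℂ := σ
  have hD : Function.Injective D := hinj p
  have hBN : B ^ N = 1 := mfderiv_pow_eq_one hf hN hfN (hιf p)
  have hs : (s (ι p)).compContinuousLinearMap B = s (ι p) := by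
    have h : (s (f (ι p))).compContinuousLinearMap B = s (ι p) := congrFun hfσ (ι p)
    rwa [hιf p] at h
  have hBD : ∀ w, B (D w) = D w := fun w => by
    have h := modelDeriv_comp (hf.mdifferentiable (by simp) (ι p)) (hι p)
    rw [show f ∘ ι = ι from funext hιf] at h
    exact (DFunLike.congr_fun h w).symm
  -- Tangent vectors along `ι` are fixed by `B`; equality of dimensions shows that they are all the
  -- fixed vectors.
  have hrange : LinearMap.range D.toLinearMap =
      LinearMap.ker (B.toLinearMap - LinearMap.id) := by
    refine Submodule.eq_of_le_of_finrank_eq ?_ ?_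
    · rintro _ ⟨w, rfl⟩
      rw [LinearMap.mem_ker, LinearMap.sub_apply, sub_eq_zero]
      exact hBD w
    · rw [LinearMap.finrank_range_of_inj hD]
      exact (hdim p).symm
  refine hD (Eq.trans ?_ (map_zero D).symm)
  refine hσ (ι p) (D v) fun w => ?_
  refine eq_zero_of_forall_fixed (β := s (ι p)) hN hBN hs (hBD v) (fun w hw => ?_) w
  have hw' : w ∈ LinearMap.range D.toLinearMap := by
    rw [hrange, LinearMap.mem_ker, LinearMap.sub_apply, sub_eq_zero]
    exact hw
  obtain ⟨u, rfl⟩ := hw'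
  refine Eq.trans ?_ (hv u)
  change s (ι p) _ = s (ι p) _
  congr 1
  ext i
  fin_cases i <;> rfl

end Pullback

end HolSymp

end

theorem proposition3p5 {n : ℕ} {M : Type*} [TopologicalSpace M]
    [ChartedSpace (EuclideanSpace ℂ (Fin n)) M]
    (σ : HolSymp.ComplexTwoForm (EuclideanSpace ℂ (Fin n)) M)
    (hσ : HolSymp.IsHolomorphicSymplectic σ)
    (h : Diffeomorph 𝓘(ℂ, EuclideanSpace ℂ (Fin n)) 𝓘(ℂ, EuclideanSpace ℂ (Fin n)) M M ω)
    (h_preserves : σ.pullback h = σ)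
    (h_finite : IsOfFinOrder (h.toEquiv : Equiv.Perm M))
    (F : Set M)
    (hF : ∃ x ∈ Function.fixedPoints h, F = connectedComponentIn (Function.fixedPoints h) x) :
    ∃ (r : ℕ) (_ : ChartedSpace (EuclideanSpace ℂ (Fin r)) F),
      Manifold.IsSmoothEmbedding 𝓘(ℂ, EuclideanSpace ℂ (Fin r)) 𝓘(ℂ, EuclideanSpace ℂ (Fin n)) ω
        (Subtype.val : F → M) ∧
      HolSymp.IsHolomorphicSymplectic
        (σ.pullback (Subtype.val : F → M) :
          HolSymp.ComplexTwoForm (EuclideanSpace ℂ (Fin r)) F) ∧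
      Even r := by
  obtain ⟨x, hx, rfl⟩ := hF
  obtain ⟨⟨-, hman, ht2, hcomp, κ, hκ⟩, hhol, hnd⟩ := hσ
  obtain ⟨N, hN, hpow⟩ := isOfFinOrder_iff_pow_eq_one.1 h_finite
  have hhN : (h : M → M)^[N] = id := by
    have h1 := Equiv.Perm.iterate_eq_pow (h.toEquiv : Equiv.Perm M) N
    rw [hpow] at h1
    exact h1
  have hxF := mem_connectedComponentIn hx
  set F := connectedComponentIn (Function.fixedPoints h) x with hFdef
  have hFfix : F ⊆ Function.fixedPoints h := connectedComponentIn_subset _ _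
  set r := HolSymp.fixedDim (E := EuclideanSpace ℂ (Fin n)) h x with hr
  have hdim : ∀ p : F, HolSymp.fixedDim (E := EuclideanSpace ℂ (Fin n)) h p = r := fun p =>
    HolSymp.fixedDim_eq_of_isPreconnected h.contMDiff hN hhN
      isPreconnected_connectedComponentIn hFfix p.2 hxF
  have hslice : ∀ p : F, Nonempty (HolSymp.SliceChart (EuclideanSpace ℂ (Fin n))
      (EuclideanSpace ℂ (Fin r)) (EuclideanSpace ℂ (Fin (n - r))) F p) := fun p => by
    have h1 := HolSymp.nonempty_sliceChart_connectedComponentIn h.contMDiff hN hhN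
      (n := n) (by simp) x p
    -- Constancy of the dimension gives all slice charts the same model space, as a single atlas
    -- requires.
    rwa [hdim p] at h1
  let s := fun p => (hslice p).some
  let cs := HolSymp.SliceChart.chartedSpace s
  have hFman := HolSymp.SliceChart.isManifold s
  have hemb := HolSymp.SliceChart.isSmoothEmbedding_val s
  have hinj := HolSymp.SliceChart.mfderiv_val_injective s
  have hFnd : (σ.pullback (Subtype.val : F → M) :
      HolSymp.ComplexTwoForm (EuclideanSpace ℂ (Fin r)) F).IsNondegenerate :=
    hnd.pullback_fixed h.contMDiff h_preserves hN hhN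
      (hemb.contMDiff.mdifferentiable (by simp)) (fun p => hFfix p.2) hinj
      (fun p => by rw [hdim]; simp)
  -- A component is closed in the fixed locus, which is closed as `M` is Hausdorff; compactness of
  -- `F` follows.
  have hFclosed : IsClosed F := by
    rw [hFdef, connectedComponentIn_eq_image hx]
    exact (isClosed_fixedPoints h.continuous).isClosedEmbedding_subtypeVal.isClosedMap _
      isClosed_connectedComponent
  refine ⟨r, cs, hemb, ⟨⟨inferInstance, hFman, inferInstance,
    isCompact_iff_compactSpace.1 hFclosed.isCompact, ⟨_, hκ.pullback hemb.contMDiff hinj⟩⟩,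
    hhol.pullback hemb.contMDiff, hFnd⟩, ?_⟩
  exact HolSymp.even_of_nondegenerate _ (hFnd ⟨x, hxF⟩)
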